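/- A $d$-dimensional framework on a finite simple graph $G=(V,E)$ is a map $p:V\to\mathbb R^d$; it is generic if the $d|V|$ coordinates of the points $p(v)$, $v\in V$, are algebraically independent over $\mathbb Q$. The graph $G$ is rigid in $\mathbb R^d$ if for every generic $p:V\to\mathbb R^d$ there is $\varepsilon>0$ such that every $q:V\to\mathbb R^d$ with $\|p(u)-q(u)\|<\varepsilon$ for all $u\in V$ and $\|p(u)-p(v)\|=\|q(u)-q(v)\|$ for all $uv\in E$ satisfies $\|p(u)-p(v)\|=\|q(u)-q(v)\|$ for all $u,v\in V$. It is minimally rigid in $\mathbb R^d$ if it is rigid in $\mathbb R^d$ and $G-e$ is not rigid in $\mathbb R^d$ for every $e\in E$. Let $\rho(G)$ denote the largest eigenvalue of the adjacency matrix of $G$, and let $K_2\nabla(n-2)K_1$ be the join of $K_2$ and the edgeless graph on $n-2$ vertices, i.e. their disjoint union together with all edges between the two. **Theorem 1.3.** Let $n\ge 3$. The graph $K_2\nabla(n-2)K_1$ is a connected graph of order $n$ that is minimally rigid in $\mathbb R^2$, and $$\rho\bigl(K_2\nabla(n-2)K_1\bigr)=\frac{1+\sqrt{8n-15}}{2}.$$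 Moreover, every connected graph $G$ of order $n$ that is minimally rigid in $\mathbb R^2$ satisfies $\rho(G)\le\rho(K_2\nabla(n-2)K_1)$, with equality if and only if $G\cong K_2\nabla(n-2)K_1$. -/

import Mathlib

/-- A `d`-dimensional framework on the vertex set `V`: a placement of the vertices in
Euclidean `d`-space. -/
abbrev Framework (V : Type*) (d : ℕ) : Type _ := V → EuclideanSpace ℝ (Fin d)

namespace Framework

/-- The frameworks `(G, p)` and `(G, q)` are equivalent: all edges of `G` have the same length
in both. -/
def Equivalent {V : Type*} {d : ℕ} (G : SimpleGraph V) (p q : Framework V d) : Prop :=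
  ∀ u v : V, G.Adj u v → ‖p u - p v‖ = ‖q u - q v‖

/-- The frameworks `p` and `q` are congruent: all pairs of vertices have the same distance
in both. -/
def Congruent {V : Type*} {d : ℕ} (p q : Framework V d) : Prop :=
  ∀ u v : V, ‖p u - p v‖ = ‖q u - q v‖

/-- The coordinates of the vertices, indexed by (vertex, coordinate), are algebraically
independent over the rationals. -/
def Generic {V : Type*} {d : ℕ} (p : Framework V d) : Prop :=
  AlgebraicIndependent ℚ (fun x : V × Fin d => (p x.1 x.2 : ℝ))

end Framework

namespace SimpleGraph

/-- `G` is rigid in `ℝᵈ`: for every generic framework `(G, p)`, each equivalent framework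
sufficiently close to it is congruent to it. -/
def IsRigid {V : Type*} (d : ℕ) (G : SimpleGraph V) : Prop :=
  ∀ p : Framework V d, p.Generic →
    ∃ ε : ℝ, 0 < ε ∧ ∀ q : Framework V d,
      Framework.Equivalent G p q → (∀ u : V, ‖p u - q u‖ < ε) → Framework.Congruent p q

/-- `G` is minimally rigid in `ℝᵈ`: it is rigid, and `G - e` is not rigid for every edge `e`. -/
def IsMinimallyRigid {V : Type*} (d : ℕ) (G : SimpleGraph V) : Prop :=
  IsRigid d G ∧ ∀ e ∈ G.edgeSet, ¬ IsRigid d (G.deleteEdges {e})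

open Classical in
/-- The (adjacency) spectral radius of a finite graph: the largest eigenvalue of its adjacency
matrix. -/
noncomputable def adjSpectralRadius {V : Type*} [Fintype V] (G : SimpleGraph V) : ℝ :=
  sSup (spectrum ℝ (G.adjMatrix ℝ))

open Classical in
/-- On a nonempty vertex set the supremum above is attained, so it is the largest eigenvalue. -/
theorem isGreatest_adjSpectralRadius {V : Type*} [Fintype V] [Nonempty V] (G : SimpleGraph V) :
    IsGreatest (spectrum ℝ (G.adjMatrix ℝ)) G.adjSpectralRadius := by
  have hA : (G.adjMatrix ℝ).IsHermitian := by
    simp [Matrix.IsHermitian, Matrix.conjTranspose_eq_transpose_of_trivial]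
  have h := hA.spectrum_real_eq_range_eigenvalues
  have hne : (spectrum ℝ (G.adjMatrix ℝ)).Nonempty := by
    rw [h]; exact Set.range_nonempty _
  have hfin : (spectrum ℝ (G.adjMatrix ℝ)).Finite := by
    rw [h]; exact Set.finite_range _
  exact ⟨hne.csSup_mem hfin, fun _ hx => le_csSup hfin.bddAbove hx⟩

/-- The join `G ∇ H`: the disjoint union of `G` and `H` together with all edges between them. -/
def joinGraph {V W : Type*} (G : SimpleGraph V) (H : SimpleGraph W) : SimpleGraph (V ⊕ W) where
  Adj
    | Sum.inl u, Sum.inl v => G.Adj u v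
    | Sum.inr u, Sum.inr v => H.Adj u v
    | Sum.inl _, Sum.inr _ => True
    | Sum.inr _, Sum.inl _ => True
  symm := ⟨by
    rintro (u | u) (v | v) h
    · exact G.adj_symm h
    · trivial
    · trivial
    · exact H.adj_symm h⟩
  loopless := ⟨by
    rintro (u | u) h
    · exact G.loopless.irrefl u h
    · exact H.loopless.irrefl u h⟩

/-- The graph `K₂ ∇ (n - 2) K₁`: the join of the complete graph on two vertices and the edgeless
graph on `n - 2` vertices (used for `n ≥ 3`). -/
def K2JoinEmpty (n : ℕ) : SimpleGraph (Fin 2 ⊕ Fin (n - 2)) :=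
  joinGraph (⊤ : SimpleGraph (Fin 2)) (⊥ : SimpleGraph (Fin (n - 2)))

end SimpleGraph

/-! ### Squared edge lengths as polynomials, and generic frameworks -/

open MvPolynomial Filter Topology

/-! Minimal rigidity enters the spectral bound through two facts only: all degrees are at least 2,
and there are at most 2n - 3 edges. A vertex with one neighbour could be rotated about it. For the
edge count, suppose one squared length is algebraic over the others: while those are kept it stays a
root of one fixed nonzero polynomial, so it cannot move continuously, and its edge is redundant.
Hence the squared lengths are algebraically independent (`IsMinimallyRigid.algebraicIndependent`),
whereas all planar distances are algebraic over 2n - 3 numbers.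

Let y be the positive eigenvector for ρ, and write d for the degree. Pairing y with d gives (ρ² - ρ)
Σ y_w = Σ (Σ_{u ~ w} d_u - d_w) y_w. The bracket equals 2m - 2(n - 1), where m is the number of
edges, minus the sum of d_u - 2 over non-neighbours u of w, so it is at most 2n - 4. Equality forces
m = 2n - 3 and every vertex to have degree 2 or be universal, which leaves only the extremal graph.
-/

theorem EuclideanSpace.norm_sub_sq_eq_sum {d : ℕ} (x y : EuclideanSpace ℝ (Fin d)) :
    ‖x - y‖ ^ 2 = ∑ i, (x i - y i) ^ 2 := by
  simp [EuclideanSpace.norm_sq_eq]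

namespace Framework

/-- The squared distance between two vertices as a polynomial in the coordinates of a
framework. -/
noncomputable def sqDistPoly {V : Type*} (d : ℕ) : Sym2 V → MvPolynomial (V × Fin d) ℚ :=
  Sym2.lift ⟨fun u v => ∑ i, (X (u, i) - X (v, i)) ^ 2, fun u v =>
    Finset.sum_congr rfl fun i _ => by ring⟩

/-- Evaluation of polynomials in the coordinates at a framework. -/
noncomputable def evalAt {V : Type*} {d : ℕ} (p : Framework V d) :
    MvPolynomial (V × Fin d) ℚ →ₐ[ℚ] ℝ :=
  aeval fun x : V × Fin d => p x.1 x.2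

theorem evalAt_sqDistPoly {V : Type*} {d : ℕ} (p : Framework V d) (u v : V) :
    evalAt p (sqDistPoly d s(u, v)) = ‖p u - p v‖ ^ 2 := by
  simp [evalAt, sqDistPoly, EuclideanSpace.norm_sub_sq_eq_sum]

theorem Generic.injective_evalAt {V : Type*} {d : ℕ} {p : Framework V d} (hp : p.Generic) :
    Function.Injective (evalAt p) := hp

theorem continuous_evalAt_sqDistPoly {V : Type*} {d : ℕ} (e : Sym2 V) :
    Continuous fun q : Framework V d => evalAt q (sqDistPoly d e) := by
  induction e with
  | _ u v =>
    simp only [evalAt_sqDistPoly]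
    fun_prop

theorem Equivalent.evalAt_eq {V : Type*} {d : ℕ} {G : SimpleGraph V} {p q : Framework V d}
    (h : Equivalent G p q) {e : Sym2 V} (he : e ∈ G.edgeSet) :
    evalAt p (sqDistPoly d e) = evalAt q (sqDistPoly d e) := by
  induction e with
  | _ u v => rw [evalAt_sqDistPoly, evalAt_sqDistPoly, h u v he]

/-- There are arbitrarily many algebraically independent real numbers, so generic frameworks
exist. -/
theorem exists_generic (V : Type*) [Finite V] (d : ℕ) : ∃ p : Framework V d, p.Generic := by
  obtain ⟨ι, x, hx⟩ := exists_isTranscendenceBasis' ℚ ℝ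
  -- Over a finite basis, ℝ would be algebraic over a countable ring, hence countable.
  have hι : Infinite ι := by
    by_contra hfin
    rw [not_infinite_iff_finite] at hfin
    have : Algebra.IsAlgebraic (Algebra.adjoin ℚ (Set.range x)) ℝ := hx.isAlgebraic
    have h1 := Algebra.IsAlgebraic.cardinalMk_le_max (Algebra.adjoin ℚ (Set.range x)) ℝ
    have h2 : Cardinal.mk (Algebra.adjoin ℚ (Set.range x)) ≤ Cardinal.aleph0 := by
      have : Countable (MvPolynomial ι ℚ) := by
        rw [← Cardinal.mk_le_aleph0_iff]
        refine (MvPolynomial.cardinalMk_le_max).trans ?_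
        simp
      have : Countable (Algebra.adjoin ℚ (Set.range x)) := by
        rw [Algebra.adjoin_range_eq_range_aeval]
        exact (AlgHom.rangeRestrict_surjective (aeval x : MvPolynomial ι ℚ →ₐ[ℚ] ℝ)).countable
      exact Cardinal.mk_le_aleph0
    rw [Cardinal.mk_real, max_eq_right h2] at h1
    exact absurd h1 (not_le.2 Cardinal.aleph0_lt_continuum)
  obtain ⟨f⟩ : Nonempty (V × Fin d ↪ ι) := by
    have := Fintype.ofFinite (V × Fin d)
    obtain ⟨s, hs⟩ := Infinite.exists_subset_card_eq ι (Fintype.card (V × Fin d))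
    have e : V × Fin d ≃ s := Fintype.equivOfCardEq (by simp [hs])
    exact ⟨e.toEmbedding.trans (Function.Embedding.subtype _)⟩
  exact ⟨fun v => WithLp.toLp 2 fun i => x (f (v, i)), hx.1.comp f f.injective⟩

theorem Generic.eq_of_apply_eq {V : Type*} {d : ℕ} {p : Framework V d} (hp : p.Generic)
    {u v : V} {i j : Fin d} (h : p u i = p v j) : u = v := by
  have := hp.injective.eq_iff (a := (u, i)) (b := (v, j))
  exact congrArg Prod.fst (this.1 h)

end Framework

/-! ### Minimal rigidity makes edge lengths independent -/

namespace SimpleGraph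

open Framework

theorem isRigid_iff_eventually {V : Type*} [Finite V] {d : ℕ} {G : SimpleGraph V} :
    IsRigid d G ↔ ∀ p : Framework V d, p.Generic →
      ∀ᶠ q : Framework V d in 𝓝 p, Equivalent G p q → Framework.Congruent p q := by
  have := Fintype.ofFinite V
  refine forall₂_congr fun p _ => ?_
  rw [Metric.eventually_nhds_iff]
  refine exists_congr fun ε => and_congr_right fun hε => forall_congr' fun q => ?_
  rw [dist_pi_lt_iff hε]
  simp only [dist_eq_norm, norm_sub_rev (q _) (p _)]
  exact forall_comm

/-- If the length of the edge `e` is algebraically dependent on other edge lengths, then `e` can be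
deleted without destroying rigidity: by closeness its length is an isolated root of the
algebraic relation. -/
theorem IsRigid.deleteEdges_of_isAlgebraic {V : Type*} [Finite V] {d : ℕ} {G : SimpleGraph V}
    (hG : IsRigid d G) {e : Sym2 V} {T : Set (Sym2 V)} (hT : T ⊆ G.edgeSet) (he : e ∉ T)
    (halg : IsAlgebraic (Algebra.adjoin ℚ (sqDistPoly d '' T)) (sqDistPoly d e)) :
    IsRigid d (G.deleteEdges {e}) := by
  rw [isRigid_iff_eventually] at hG ⊢
  intro p hp
  set S := Algebra.adjoin ℚ (sqDistPoly (V := V) d '' T) with hS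
  obtain ⟨Q, hQ, hroot⟩ := halg
  let r : Framework V d → S →+* ℝ := fun q => (evalAt q).toRingHom.comp S.val.toRingHom
  have hroot' : ∀ q : Framework V d, (Q.map (r q)).IsRoot (evalAt q (sqDistPoly d e)) := by
    intro q
    have h := congrArg (evalAt q) hroot
    rw [map_zero, Polynomial.aeval_def] at h
    rw [Polynomial.IsRoot, Polynomial.eval_map]
    have h2 := Polynomial.hom_eval₂ Q (algebraMap S (MvPolynomial (V × Fin d) ℚ))
      (evalAt q).toRingHom (sqDistPoly d e)
    exact h2.symm.trans h
  -- The coefficients of `Q` involve only lengths that `q` shares with `p`, so both lengths of `e`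
  -- are roots of the same polynomial. It is nonzero because evaluation at a generic `p` is
  -- injective.
  have hr : ∀ q : Framework V d, Equivalent (G.deleteEdges {e}) p q → r q = r p := by
    intro q hq
    ext ⟨x, hx⟩
    have : Set.EqOn (evalAt q) (evalAt p) S := by
      refine AlgHom.eqOn_adjoin_iff.2 ?_
      rintro _ ⟨f, hf, rfl⟩
      refine (hq.evalAt_eq ?_).symm
      rw [edgeSet_deleteEdges]
      exact ⟨hT hf, fun h => he (h ▸ hf)⟩
    exact this hx
  have hne : Q.map (r p) ≠ 0 := by
    rw [Polynomial.map_ne_zero_iff]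
    · exact hQ
    · exact hp.injective_evalAt.comp Subtype.val_injective
  have hfin : ((Q.map (r p)).roots.toFinset.erase (evalAt p (sqDistPoly d e)) : Set ℝ).Finite :=
    Finset.finite_toSet _
  have hopen := hfin.isClosed.isOpen_compl.mem_nhds
    (show evalAt p (sqDistPoly d e) ∈ _ by simp)
  filter_upwards [hG p hp, (continuous_evalAt_sqDistPoly e).continuousAt.eventually hopen]
    with q hq hqe heq
  refine hq ?_
  have hval : evalAt q (sqDistPoly d e) = evalAt p (sqDistPoly d e) := by
    by_contra hcon
    refine hqe ?_
    have := hroot' q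
    rw [hr q heq] at this
    simpa [hne, hcon] using this
  intro u v huv
  by_cases h : s(u, v) = e
  · subst h
    rw [evalAt_sqDistPoly, evalAt_sqDistPoly] at hval
    exact ((sq_eq_sq₀ (norm_nonneg _) (norm_nonneg _)).1 hval).symm
  · exact heq u v (by simpa [huv] using h)

/-- The squared edge lengths of a minimally rigid graph are algebraically independent. -/
theorem IsMinimallyRigid.algebraicIndependent {V : Type*} [Finite V] {d : ℕ} {G : SimpleGraph V}
    (hG : IsMinimallyRigid d G) :
    AlgebraicIndependent ℚ fun e : G.edgeSet => sqDistPoly d e.1 := by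
  refine algebraicIndependent_of_finite_type' (algebraMap ℚ _).injective
    fun t _ _ e het halg => hG.2 e.1 e.2 ?_
  refine hG.1.deleteEdges_of_isAlgebraic (T := Subtype.val '' t) ?_ ?_ ?_
  · rintro _ ⟨f, -, rfl⟩
    exact f.2
  · rintro ⟨f, hf, hfe⟩
    exact het (Subtype.ext hfe ▸ hf)
  · rwa [Set.image_image]

end SimpleGraph

/-- In the matroid of algebraic independence, an independent set inside the closure of `S` has at
most rank-of-`S` many elements. -/
theorem AlgebraicIndependent.encard_range_le_of_isAlgebraic {ι F A : Type*} [Field F] [Field A]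
    [Algebra F A] {x : ι → A} (hx : AlgebraicIndependent F x) {S : Set A}
    (h : ∀ i, IsAlgebraic (Algebra.adjoin F S) (x i)) : (Set.range x).encard ≤ S.encard := by
  have hind : (AlgebraicIndependent.matroid F A).Indep (Set.range x) := hx.to_subtype_range
  have hsub : Set.range x ⊆ (AlgebraicIndependent.matroid F A).closure S := by
    rw [matroid_closure_eq]
    rintro _ ⟨i, rfl⟩
    exact h i
  calc (Set.range x).encard = (AlgebraicIndependent.matroid F A).eRk (Set.range x) :=
        hind.eRk_eq_encard.symm
    _ ≤ (AlgebraicIndependent.matroid F A).eRk ((AlgebraicIndependent.matroid F A).closure S) :=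
        Matroid.eRk_mono _ hsub
    _ = (AlgebraicIndependent.matroid F A).eRk S := Matroid.eRk_closure_eq _ _
    _ ≤ S.encard := Matroid.eRk_le_encard _ _

/-! ### Planar coordinates relative to a pair of vertices, and the edge count -/

namespace Framework

theorem norm_sub_sq_eq {V : Type*} (p : Framework V 2) (u v : V) :
    ‖p u - p v‖ ^ 2 = (p u 0 - p v 0) ^ 2 + (p u 1 - p v 1) ^ 2 := by
  rw [EuclideanSpace.norm_sub_sq_eq_sum, Fin.sum_univ_two]

theorem norm_sub_eq_iff {V : Type*} (p q : Framework V 2) (u v : V) :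
    ‖p u - p v‖ = ‖q u - q v‖ ↔ (p u 0 - p v 0) ^ 2 + (p u 1 - p v 1) ^ 2 =
      (q u 0 - q v 0) ^ 2 + (q u 1 - q v 1) ^ 2 := by
  rw [← norm_sub_sq_eq, ← norm_sub_sq_eq, sq_eq_sq₀ (norm_nonneg _) (norm_nonneg _)]

/-- The inner product of `p v - p u` and `p w - p u`. -/
def dot {V : Type*} (p : Framework V 2) (u v w : V) : ℝ :=
  (p v 0 - p u 0) * (p w 0 - p u 0) + (p v 1 - p u 1) * (p w 1 - p u 1)

/-- Twice the signed area of the triangle `p u`, `p v`, `p w`. -/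
def cross {V : Type*} (p : Framework V 2) (u v w : V) : ℝ :=
  (p v 0 - p u 0) * (p w 1 - p u 1) - (p v 1 - p u 1) * (p w 0 - p u 0)

/-- Pythagoras in the orthogonal frame along `p v - p u`: `dot` and `cross` are the coordinates in
it, scaled by the length of that vector. -/
theorem dot_self_mul_norm_sub_sq {V : Type*} (p : Framework V 2) (u v w w' : V) :
    dot p u v v * ‖p w - p w'‖ ^ 2 =
      (dot p u v w - dot p u v w') ^ 2 + (cross p u v w - cross p u v w') ^ 2 := by
  rw [norm_sub_sq_eq, dot, dot, dot, cross, cross]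
  ring

theorem Generic.dot_self_ne_zero {V : Type*} {p : Framework V 2} (hp : p.Generic) {u v : V}
    (h : u ≠ v) : dot p u v v ≠ 0 := by
  intro h0
  have h1 : (p v 0 - p u 0) = 0 := by
    rw [dot] at h0
    nlinarith [sq_nonneg (p v 0 - p u 0), sq_nonneg (p v 1 - p u 1)]
  exact h (hp.eq_of_apply_eq (sub_eq_zero.1 h1)).symm

theorem Generic.cross_ne_zero {V : Type*} {p : Framework V 2} (hp : p.Generic) {u v w : V}
    (huv : u ≠ v) (huw : u ≠ w) (hvw : v ≠ w) : cross p u v w ≠ 0 := by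
  classical
  intro h0
  let P : MvPolynomial (V × Fin 2) ℚ :=
    (X (v, 0) - X (u, 0)) * (X (w, 1) - X (u, 1)) - (X (v, 1) - X (u, 1)) * (X (w, 0) - X (u, 0))
  have hP : P = 0 := by
    refine hp.injective_evalAt ?_
    rw [map_zero, ← h0]
    simp [P, evalAt, cross]
  -- Put `v` at (1, 0), `w` at (0, 1) and all else at the origin: the determinant is 1.
  have := congrArg (MvPolynomial.eval fun x : V × Fin 2 =>
    if x = (v, 0) then 1 else if x = (w, 1) then 1 else 0) hP
  simp [P, huv, huw, hvw, hvw.symm] at this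

end Framework

namespace SimpleGraph

open Framework

/-- All squared distances of a planar framework are algebraic over `2 |V| - 3` numbers, so at most
that many edge lengths can be independent. -/
theorem ncard_edgeSet_le_of_algebraicIndependent {V : Type*} [Finite V] {G : SimpleGraph V}
    (hV : 2 ≤ Nat.card V) (hG : AlgebraicIndependent ℚ fun e : G.edgeSet => sqDistPoly 2 e.1) :
    G.edgeSet.ncard ≤ 2 * Nat.card V - 3 := by
  classical
  have := Fintype.ofFinite V
  rw [Nat.card_eq_fintype_card] at hV ⊢
  obtain ⟨u, v, huv⟩ := Fintype.exists_pair_of_one_lt_card hV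
  obtain ⟨p, hp⟩ := exists_generic V 2
  have hx := hG.map' (f := evalAt p) hp.injective_evalAt
  let W : Finset V := (Finset.univ.erase u).erase v
  have hW : W.card = Fintype.card V - 2 := by
    rw [Finset.card_erase_of_mem (by simp [huv.symm]), Finset.card_erase_of_mem (by simp),
      Finset.card_univ]
    rfl
  -- At most 1 + 2(n - 2) = 2n - 3 numbers: the remaining values of `dot` and `cross`, at `u` and
  -- `v`, vanish.
  let S : Finset ℝ := insert (dot p u v v) (W.image (dot p u v) ∪ W.image (cross p u v))
  have hScard : S.card ≤ 2 * Fintype.card V - 3 := by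
    have h1 := Finset.card_insert_le (dot p u v v) (W.image (dot p u v) ∪ W.image (cross p u v))
    have h2 := Finset.card_union_le (W.image (dot p u v)) (W.image (cross p u v))
    have h3 := Finset.card_image_le (s := W) (f := dot p u v)
    have h4 := Finset.card_image_le (s := W) (f := cross p u v)
    change (insert _ _ : Finset ℝ).card ≤ _
    omega
  have hmem : ∀ x ∈ S, IsAlgebraic (Algebra.adjoin ℚ (S : Set ℝ)) x := fun x hx =>
    isAlgebraic_algebraMap (⟨x, Algebra.subset_adjoin hx⟩ : Algebra.adjoin ℚ (S : Set ℝ))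
  have hdot : ∀ w, IsAlgebraic (Algebra.adjoin ℚ (S : Set ℝ)) (dot p u v w) := by
    intro w
    by_cases hwu : w = u
    · have : dot p u v w = 0 := by simp [dot, hwu]
      rw [this]
      exact isAlgebraic_zero
    by_cases hwv : w = v
    · rw [hwv]
      exact hmem _ (Finset.mem_insert_self _ _)
    · exact hmem _ (Finset.mem_insert_of_mem (Finset.mem_union_left _
        (Finset.mem_image_of_mem _ (by simp [W, hwu, hwv]))))
  have hcross : ∀ w, IsAlgebraic (Algebra.adjoin ℚ (S : Set ℝ)) (cross p u v w) := by
    intro w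
    by_cases hwu : w = u
    · have : cross p u v w = 0 := by simp [cross, hwu]
      rw [this]
      exact isAlgebraic_zero
    by_cases hwv : w = v
    · have : cross p u v w = 0 := by
        rw [cross, hwv]
        ring
      rw [this]
      exact isAlgebraic_zero
    · exact hmem _ (Finset.mem_insert_of_mem (Finset.mem_union_right _
        (Finset.mem_image_of_mem _ (by simp [W, hwu, hwv]))))
  have halg : ∀ e : G.edgeSet,
      IsAlgebraic (Algebra.adjoin ℚ (S : Set ℝ)) (evalAt p (sqDistPoly 2 e.1)) := by
    rintro ⟨e, -⟩
    induction e with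
    | _ w w' =>
      have h := dot_self_mul_norm_sub_sq p u v w w'
      have h0 := hp.dot_self_ne_zero huv
      have : evalAt p (sqDistPoly 2 s(w, w')) = ((dot p u v w - dot p u v w') ^ 2 +
          (cross p u v w - cross p u v w') ^ 2) * (dot p u v v)⁻¹ := by
        rw [evalAt_sqDistPoly, ← h]
        field_simp
      rw [this]
      exact ((((hdot w).sub (hdot w')).pow 2).add (((hcross w).sub (hcross w')).pow 2)).mul
        (hdot v).inv
  have hle := hx.encard_range_le_of_isAlgebraic halg
  have hinj : Function.Injective fun e : G.edgeSet => evalAt p (sqDistPoly 2 e.1) := hx.injective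
  have hcard : G.edgeSet.encard ≤ (S : Set ℝ).encard := by
    refine le_trans (le_of_eq ?_) hle
    rw [← Set.image_univ]
    exact ((hinj.encard_image _).trans (Set.encard_univ _)).symm
  rw [Set.encard_coe_eq_coe_finsetCard, Set.encard_le_coe_iff_finite_ncard_le] at hcard
  exact hcard.2.trans hScard

/-! ### Rigidity and flexes around the extremal graph -/

/-- Two adjacent vertices joined to everything else make a planar graph rigid. -/
theorem isRigid_of_adj_pair {V : Type*} [Finite V] {G : SimpleGraph V} {u v : V}
    (huv : G.Adj u v) (h : ∀ w, w ≠ u → w ≠ v → G.Adj u w ∧ G.Adj v w) : IsRigid 2 G := by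
  rw [isRigid_iff_eventually]
  intro p hp
  have hcont : ∀ w, Continuous fun q : Framework V 2 => cross q u v w := by
    intro w
    unfold cross
    fun_prop
  -- The lengths determine `cross` only up to sign, i.e. up to reflecting `w` in the line through
  -- `u` and `v`. Closeness to `p` excludes the reflection.
  have hsign : ∀ᶠ q : Framework V 2 in 𝓝 p, ∀ w, w ≠ u → w ≠ v →
      0 < cross p u v w * cross q u v w := by
    rw [eventually_all]
    intro w
    by_cases hw : w ≠ u ∧ w ≠ v
    · have h0 : 0 < cross p u v w * cross p u v w :=
        mul_self_pos.2 (hp.cross_ne_zero huv.ne hw.1.symm hw.2.symm)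
      have hc : Continuous fun q : Framework V 2 => cross p u v w * cross q u v w :=
        continuous_const.mul (hcont w)
      filter_upwards [hc.continuousAt.eventually_const_lt h0] with q hq _ _ using hq
    · filter_upwards with q h1 h2 using absurd ⟨h1, h2⟩ hw
  filter_upwards [hsign] with q hq heq
  have hNe : dot p u v v = dot q u v v := by
    have := (norm_sub_eq_iff p q u v).1 (heq u v huv)
    rw [dot, dot]
    linarith
  have hdot : ∀ w, dot p u v w = dot q u v w := by
    intro w
    by_cases hwu : w = u
    · simp [dot, hwu]
    by_cases hwv : w = v
    · rw [hwv, hNe]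
    have h1 := (norm_sub_eq_iff p q u w).1 (heq u w (h w hwu hwv).1)
    have h2 := (norm_sub_eq_iff p q v w).1 (heq v w (h w hwu hwv).2)
    rw [dot, dot] at hNe ⊢
    linarith
  have hcross : ∀ w, cross p u v w = cross q u v w := by
    intro w
    by_cases hwu : w = u
    · simp [cross, hwu]
    by_cases hwv : w = v
    · rw [hwv, cross, cross]
      ring
    have h1 := (norm_sub_eq_iff p q u w).1 (heq u w (h w hwu hwv).1)
    have h2 : cross p u v w ^ 2 = cross q u v w ^ 2 := by
      have hp2 : cross p u v w ^ 2 = dot p u v v * ((p u 0 - p w 0) ^ 2 + (p u 1 - p w 1) ^ 2)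
          - dot p u v w ^ 2 := by
        rw [cross, dot, dot]
        ring
      have hq2 : cross q u v w ^ 2 = dot q u v v * ((q u 0 - q w 0) ^ 2 + (q u 1 - q w 1) ^ 2)
          - dot q u v w ^ 2 := by
        rw [cross, dot, dot]
        ring
      rw [hp2, hq2, h1, hNe, hdot w]
    rcases sq_eq_sq_iff_eq_or_eq_neg.1 h2 with h3 | h3
    · exact h3
    · have := hq w hwu hwv
      rw [h3] at this
      nlinarith [sq_nonneg (cross q u v w)]
  intro w w'
  have h0 := hp.dot_self_ne_zero huv.ne
  have hp3 := dot_self_mul_norm_sub_sq p u v w w'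
  have hq3 := dot_self_mul_norm_sub_sq q u v w w'
  rw [← hdot, ← hdot, ← hdot, ← hcross, ← hcross, ← hp3] at hq3
  exact ((sq_eq_sq₀ (norm_nonneg _) (norm_nonneg _)).1 (mul_left_cancel₀ h0 hq3)).symm

/-- A vertex with at most one neighbour can be rotated about that neighbour. -/
theorem not_isRigid_of_subsingleton_neighbor {V : Type*} [Finite V] {G : SimpleGraph V} {u v w : V}
    (huv : u ≠ v) (huw : u ≠ w) (hvw : v ≠ w) (h : ∀ x, G.Adj v x → x = u) : ¬ IsRigid 2 G := by
  classical
  intro hG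
  rw [isRigid_iff_eventually] at hG
  obtain ⟨p, hp⟩ := exists_generic V 2
  let c : ℝ → Framework V 2 := fun t => Function.update p v !₂[
    p u 0 + (Real.cos t * (p v 0 - p u 0) - Real.sin t * (p v 1 - p u 1)),
    p u 1 + (Real.sin t * (p v 0 - p u 0) + Real.cos t * (p v 1 - p u 1))]
  have hc : Continuous c := by
    refine continuous_const.update v ?_
    fun_prop
  have hc0 : c 0 = p := by
    refine Function.update_eq_self_iff.2 ?_
    ext i
    fin_cases i <;> simp
  have hcv : ∀ t, c t v = !₂[
    p u 0 + (Real.cos t * (p v 0 - p u 0) - Real.sin t * (p v 1 - p u 1)),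
    p u 1 + (Real.sin t * (p v 0 - p u 0) + Real.cos t * (p v 1 - p u 1))] := fun t => by simp [c]
  have hcx : ∀ t x, x ≠ v → c t x = p x := fun t x hx => by simp [c, hx]
  have hlen : ∀ t, ‖p v - p u‖ = ‖c t v - c t u‖ := by
    intro t
    rw [norm_sub_eq_iff, hcv, hcx t u huv]
    simp
    linear_combination (-((p v 0 - p u 0) ^ 2 + (p v 1 - p u 1) ^ 2)) * Real.sin_sq_add_cos_sq t
  have hequiv : ∀ t, Equivalent G p (c t) := by
    intro t x y hxy
    by_cases hx : x = v
    · subst hx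
      rw [h y hxy]
      exact hlen t
    by_cases hy : y = v
    · subst hy
      rw [h x hxy.symm, norm_sub_rev, norm_sub_rev (c t u)]
      exact hlen t
    rw [hcx t x hx, hcx t y hy]
  have hev : ∀ᶠ t in 𝓝 (0 : ℝ), Framework.Congruent p (c t) := by
    have := hc.tendsto 0
    rw [hc0] at this
    filter_upwards [this.eventually (hG p hp)] with t ht using ht (hequiv t)
  -- Comparing the rotations by `t` and `-t` cancels the cosine terms and leaves `sin t` times
  -- `cross`.
  have hev2 : ∀ᶠ t in 𝓝 (0 : ℝ), Framework.Congruent p (c (-t)) := by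
    have : Tendsto (fun t : ℝ => -t) (𝓝 0) (𝓝 0) := by
      simpa using (continuous_neg (G := ℝ)).tendsto 0
    exact this.eventually hev
  obtain ⟨t, ⟨ht1, ht2⟩, ht3⟩ := (((hev.and hev2).filter_mono
    (nhdsWithin_le_nhds (s := Set.Ioi 0))).and (Ioo_mem_nhdsGT one_pos)).exists
  have hs : 0 < Real.sin t := Real.sin_pos_of_pos_of_lt_pi ht3.1 (by linarith [ht3.2, Real.pi_gt_three])
  have e1 := (norm_sub_eq_iff _ _ _ _).1 (ht1 v w)
  have e2 := (norm_sub_eq_iff _ _ _ _).1 (ht2 v w)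
  rw [hcv, hcx _ w hvw.symm] at e1 e2
  simp at e1 e2
  have hsc := Real.sin_sq_add_cos_sq t
  set s := Real.sin t
  set k := Real.cos t
  have hcr : cross p u v w = 0 := by
    have : s * cross p u v w = 0 := by
      rw [cross]
      linear_combination (e1 - e2) / 4
    exact (mul_eq_zero.1 this).resolve_left hs.ne'
  exact hp.cross_ne_zero huv huw hvw hcr

end SimpleGraph

namespace SimpleGraph

open Framework

/-- If every edge meets `{u, v}` and `u`, `v` are not adjacent, then a planar realization can be
deformed by pulling `u` and `v` apart. -/
theorem not_isRigid_of_not_adj_pair {V : Type*} [Finite V] {G : SimpleGraph V} {u v : V}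
    (huv : u ≠ v) (hnadj : ¬ G.Adj u v)
    (h : ∀ x y, G.Adj x y → x = u ∨ x = v ∨ y = u ∨ y = v) : ¬ IsRigid 2 G := by
  classical
  intro hG
  rw [isRigid_iff_eventually] at hG
  obtain ⟨p, hp⟩ := exists_generic V 2
  have hN := hp.dot_self_ne_zero huv
  set N := dot p u v v with hNdef
  -- The sign keeps `w` on its original side of the line, so that the flex passes through `p` at `s
  -- = 1`.
  have hσ : ∀ w, ∃ σ : ℝ, σ ^ 2 = 1 ∧ σ * |cross p u v w| = cross p u v w := by
    intro w
    rcases abs_choice (cross p u v w) with h1 | h1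
    · exact ⟨1, by norm_num, by rw [h1, one_mul]⟩
    · exact ⟨-1, by norm_num, by rw [h1]; ring⟩
  choose σ hσ1 hσ2 using hσ
  -- The vector from `u` to `v` is stretched by `s`. Keeping the distances of `w` to both ends
  -- forces its new `dot` and `cross` against the old vector `p v - p u` to be `g` and `f`, with `g²
  -- + f² = N * dot p u w w`.
  let g : V → ℝ → ℝ := fun w s => ((s ^ 2 - 1) * N + 2 * dot p u v w) / (2 * s)
  let k : V → ℝ → ℝ := fun w s => N * dot p u w w - g w s ^ 2
  let f : V → ℝ → ℝ := fun w s => σ w * √(k w s)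
  let c : ℝ → Framework V 2 := fun s w => if w = u then p u else if w = v then
      !₂[p u 0 + s * (p v 0 - p u 0), p u 1 + s * (p v 1 - p u 1)] else
      !₂[p u 0 + (g w s * (p v 0 - p u 0) - f w s * (p v 1 - p u 1)) / N,
        p u 1 + (g w s * (p v 1 - p u 1) + f w s * (p v 0 - p u 0)) / N]
  have hg : ∀ w, ContinuousAt (g w) 1 := fun w => by
    refine ContinuousAt.div (by fun_prop) (by fun_prop) (by norm_num)
  have hg1 : ∀ w, g w 1 = dot p u v w := fun w => by simp [g]
  have hk : ∀ w, ContinuousAt (k w) 1 := fun w => by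
    have := hg w
    fun_prop
  have hk1 : ∀ w, k w 1 = cross p u v w ^ 2 := fun w => by
    simp only [k, hg1, hNdef]
    simp only [dot, cross]
    ring
  have hf : ∀ w, ContinuousAt (f w) 1 := fun w => by
    have := hk w
    fun_prop
  have hf1 : ∀ w, f w 1 = cross p u v w := fun w => by
    simp only [f, hk1, Real.sqrt_sq_eq_abs, hσ2]
  have hcu : ∀ s, c s u = p u := fun s => by simp [c]
  have hcv : ∀ s, c s v = !₂[p u 0 + s * (p v 0 - p u 0), p u 1 + s * (p v 1 - p u 1)] :=
    fun s => by simp [c, huv.symm]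
  have hcw : ∀ s w, w ≠ u → w ≠ v → c s w =
      !₂[p u 0 + (g w s * (p v 0 - p u 0) - f w s * (p v 1 - p u 1)) / N,
        p u 1 + (g w s * (p v 1 - p u 1) + f w s * (p v 0 - p u 0)) / N] :=
    fun s w h1 h2 => by simp [c, h1, h2]
  have hc1 : c 1 = p := by
    ext w i
    by_cases hwu : w = u
    · rw [hwu, hcu]
    by_cases hwv : w = v
    · rw [hwv, hcv]
      fin_cases i <;> simp
    rw [hcw _ _ hwu hwv, hg1, hf1]
    fin_cases i
    · simp
      field_simp
      rw [hNdef]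
      simp only [dot, cross]
      ring
    · simp
      field_simp
      rw [hNdef]
      simp only [dot, cross]
      ring
  have hc : ContinuousAt c 1 := by
    refine continuousAt_pi.2 fun w => ?_
    by_cases hwu : w = u
    · subst hwu
      simp only [hcu]
      exact continuousAt_const
    by_cases hwv : w = v
    · subst hwv
      simp only [hcv]
      fun_prop
    simp only [fun s => hcw s w hwu hwv]
    have h1 := hg w
    have h2 := hf w
    fun_prop
  -- The square root in `f` squares back to `k` only where `k` is nonnegative; non-collinearity at
  -- `s = 1` ensures this nearby.
  have hpos : ∀ᶠ s in 𝓝 (1 : ℝ), ∀ w, w ≠ u → w ≠ v → 0 < k w s := by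
    rw [eventually_all]
    intro w
    by_cases hw : w ≠ u ∧ w ≠ v
    · have h0 : 0 < k w 1 := by
        rw [hk1]
        exact sq_pos_of_ne_zero (hp.cross_ne_zero huv hw.1.symm hw.2.symm)
      filter_upwards [(hk w).eventually_const_lt h0] with s hs _ _ using hs
    · filter_upwards with q h1 h2 using absurd ⟨h1, h2⟩ hw
  have hlen : ∀ s, 0 < s → (∀ w, w ≠ u → w ≠ v → 0 < k w s) → ∀ w, w ≠ u → w ≠ v →
      ‖p w - p u‖ = ‖c s w - c s u‖ ∧ ‖p w - p v‖ = ‖c s w - c s v‖ := by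
    intro s hs hsk w hwu hwv
    have hf2 : f w s ^ 2 = N * dot p u w w - g w s ^ 2 := by
      simp only [f]
      rw [mul_pow, hσ1, one_mul, Real.sq_sqrt (hsk w hwu hwv).le]
    have hg2 : 2 * s * g w s = (s ^ 2 - 1) * N + 2 * dot p u v w := by
      simp only [g]
      field_simp
    rw [norm_sub_eq_iff, norm_sub_eq_iff, hcu, hcv, hcw s w hwu hwv]
    have hNe : N = (p v 0 - p u 0) ^ 2 + (p v 1 - p u 1) ^ 2 := by
      rw [hNdef, dot]
      ring
    have hR : dot p u w w = (p w 0 - p u 0) ^ 2 + (p w 1 - p u 1) ^ 2 := by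
      rw [dot]
      ring
    have hD : dot p u v w =
      (p v 0 - p u 0) * (p w 0 - p u 0) + (p v 1 - p u 1) * (p w 1 - p u 1) := rfl
    generalize g w s = γ at *
    generalize f w s = φ at *
    set R := dot p u w w
    set D := dot p u v w
    have key1 : ((γ * (p v 0 - p u 0) - φ * (p v 1 - p u 1)) / N) ^ 2 +
        ((γ * (p v 1 - p u 1) + φ * (p v 0 - p u 0)) / N) ^ 2 = R := by
      field_simp
      linear_combination (-(γ ^ 2 + φ ^ 2)) * hNe + N * hf2
    have key2 : ((γ * (p v 0 - p u 0) - φ * (p v 1 - p u 1)) / N) * (p v 0 - p u 0) +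
        ((γ * (p v 1 - p u 1) + φ * (p v 0 - p u 0)) / N) * (p v 1 - p u 1) = γ := by
      field_simp
      linear_combination (-γ) * hNe
    simp
    constructor
    · rw [key1, hR]
    · linear_combination (-1) * key1 + 2 * s * key2 - hR + 2 * hD + hg2 + (s ^ 2 - 1) * hNe
  have hev : ∀ᶠ s in 𝓝 (1 : ℝ), Framework.Congruent p (c s) := by
    have ht : Tendsto c (𝓝 1) (𝓝 p) := by
      have := hc.tendsto
      rwa [hc1] at this
    filter_upwards [ht.eventually (hG p hp), hpos, lt_mem_nhds (one_pos (α := ℝ))]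
      with s hs hsk hs0
    refine hs ?_
    have hl := hlen s hs0 hsk
    have hone : ∀ x y, G.Adj x y → x = u ∨ x = v → ‖p x - p y‖ = ‖c s x - c s y‖ := by
      rintro x y hxy (rfl | rfl)
      · rw [norm_sub_rev, norm_sub_rev (c s x)]
        exact (hl y hxy.ne' fun hy => hnadj (hy ▸ hxy)).1
      · rw [norm_sub_rev, norm_sub_rev (c s x)]
        exact (hl y (fun hy => hnadj (hy ▸ hxy.symm)) hxy.ne').2
    intro x y hxy
    rcases h x y hxy with h1 | h1 | h1 | h1
    · exact hone x y hxy (Or.inl h1)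
    · exact hone x y hxy (Or.inr h1)
    · rw [norm_sub_rev, norm_sub_rev (c s x)]
      exact hone y x hxy.symm (Or.inl h1)
    · rw [norm_sub_rev, norm_sub_rev (c s x)]
      exact hone y x hxy.symm (Or.inr h1)
  obtain ⟨s, hs, hs1⟩ := ((hev.filter_mono
    (nhdsWithin_le_nhds (s := Set.Ioi 1))).and self_mem_nhdsWithin).exists
  change 1 < s at hs1
  have e := (norm_sub_eq_iff _ _ _ _).1 (hs v u)
  rw [hcv, hcu] at e
  simp at e
  have : (s ^ 2 - 1) * N = 0 := by
    rw [hNdef, dot]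
    linear_combination -e
  rcases mul_eq_zero.1 this with h1 | h1
  · nlinarith
  · exact hN h1

theorem K2JoinEmpty_isMinimallyRigid (n : ℕ) : IsMinimallyRigid 2 (K2JoinEmpty n) := by
  constructor
  · refine isRigid_of_adj_pair (u := Sum.inl 0) (v := Sum.inl 1) ?_ ?_
    · simp [K2JoinEmpty, joinGraph]
    · rintro (w | w) h1 h2
      · fin_cases w <;> simp at h1 h2
      · simp [K2JoinEmpty, joinGraph]
  · have hleaf : ∀ (i : Fin 2) (w : Fin (n - 2)),
        ¬ IsRigid 2 ((K2JoinEmpty n).deleteEdges {s(Sum.inl i, Sum.inr w)}) := by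
      intro i w
      -- In `Fin 2`, `i + 1` is the other hub, the only neighbour left to `w`.
      refine not_isRigid_of_subsingleton_neighbor (u := Sum.inl (i + 1)) (v := Sum.inr w)
        (w := Sum.inl i) (by simp) ?_ (by simp) ?_
      · fin_cases i <;> simp
      · rintro (x | x) hx
        · simp [K2JoinEmpty, joinGraph] at hx
          fin_cases i <;> fin_cases x <;> simp_all
        · simp [K2JoinEmpty, joinGraph] at hx
    have hhub : ¬ IsRigid 2 ((K2JoinEmpty n).deleteEdges {s(Sum.inl 0, Sum.inl 1)}) := by
      refine not_isRigid_of_not_adj_pair (u := Sum.inl 0) (v := Sum.inl 1) (by simp) (by simp) ?_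
      rintro (x | x) (y | y) h
      · fin_cases x <;> simp
      · fin_cases x <;> simp
      · fin_cases y <;> simp
      · simp [K2JoinEmpty, joinGraph] at h
    intro e he
    induction e with
    | _ x y =>
      rcases x with x | x <;> rcases y with y | y
      · fin_cases x <;> fin_cases y
        · simp at he
        · exact hhub
        · rw [Sym2.eq_swap]
          exact hhub
        · simp at he
      · exact hleaf x y
      · rw [Sym2.eq_swap]
        exact hleaf y x
      · simp [K2JoinEmpty, joinGraph] at he

theorem K2JoinEmpty_connected (n : ℕ) : (K2JoinEmpty n).Connected := by
  rw [connected_iff_exists_forall_reachable]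
  refine ⟨Sum.inl 0, ?_⟩
  rintro (x | x)
  · fin_cases x
    · exact Reachable.refl _
    · exact Adj.reachable (by simp [K2JoinEmpty, joinGraph])
  · exact Adj.reachable (by simp [K2JoinEmpty, joinGraph])

end SimpleGraph

/-! ### The spectral bound -/

namespace SimpleGraph

open Framework Matrix

open Classical in
theorem mem_spectrum_adjMatrix_iff {V : Type*} [Fintype V] (G : SimpleGraph V) (r : ℝ) :
    r ∈ spectrum ℝ (G.adjMatrix ℝ) ↔ ∃ x : V → ℝ, x ≠ 0 ∧ G.adjMatrix ℝ *ᵥ x = r • x := by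
  rw [← Matrix.spectrum_toLin', ← Module.End.hasEigenvalue_iff_mem_spectrum]
  constructor
  · intro h
    obtain ⟨x, hx⟩ := h.exists_hasEigenvector
    exact ⟨x, hx.2, by simpa using hx.apply_eq_smul⟩
  · rintro ⟨x, hx0, hx⟩
    exact Module.End.hasEigenvalue_of_hasEigenvector
      ⟨Module.End.mem_eigenspace_iff.2 (by simpa using hx), hx0⟩

open Classical in
theorem isHermitian_adjMatrix_real {V : Type*} (G : SimpleGraph V) :
    (G.adjMatrix ℝ).IsHermitian := by
  simp [Matrix.IsHermitian, Matrix.conjTranspose_eq_transpose_of_trivial]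

open Classical in
/-- A connected graph has a positive eigenvector for its spectral radius. -/
theorem Connected.exists_pos_eigenvector {V : Type*} [Fintype V] {G : SimpleGraph V}
    (hG : G.Connected) :
    ∃ y : V → ℝ, (∀ v, 0 < y v) ∧ G.adjMatrix ℝ *ᵥ y = G.adjSpectralRadius • y := by
  have := hG.nonempty
  set A := G.adjMatrix ℝ with hA
  set r := G.adjSpectralRadius
  have hgreat : IsGreatest (spectrum ℝ A) r := isGreatest_adjSpectralRadius G
  obtain ⟨x, hx0, hx⟩ := (mem_spectrum_adjMatrix_iff G r).1 hgreat.1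
  -- A positive semidefinite form vanishes only on its kernel. Passing from `x` to `|x|` does not
  -- lower the quadratic form of `A`, so `|x|` is again an eigenvector for `r`.
  have hpsd : (algebraMap ℝ (Matrix V V ℝ) r - A).PosSemidef := by
    rw [posSemidef_iff_isHermitian_and_spectrum_nonneg]
    constructor
    · refine Matrix.IsHermitian.sub ?_ (isHermitian_adjMatrix_real G)
      rw [Matrix.IsHermitian, Matrix.conjTranspose_eq_transpose_of_trivial,
        Matrix.algebraMap_eq_diagonal, Matrix.diagonal_transpose]
    · rw [← spectrum.singleton_sub_eq]
      rintro _ ⟨_, rfl, s, hs, rfl⟩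
      exact sub_nonneg.2 (hgreat.2 hs)
  have hmul : ∀ z : V → ℝ, (algebraMap ℝ (Matrix V V ℝ) r - A) *ᵥ z = r • z - A *ᵥ z := by
    intro z
    rw [Matrix.sub_mulVec, Algebra.algebraMap_eq_smul_one, Matrix.smul_mulVec, Matrix.one_mulVec]
  set y : V → ℝ := fun v => |x v| with hy
  have hle : x ⬝ᵥ A *ᵥ x ≤ y ⬝ᵥ A *ᵥ y := by
    simp only [hA, dotProduct, adjMatrix_mulVec_apply, Finset.mul_sum]
    refine Finset.sum_le_sum fun v _ => Finset.sum_le_sum fun u _ => ?_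
    rw [hy, ← abs_mul]
    exact le_abs_self _
  have heq : x ⬝ᵥ (r • x) = y ⬝ᵥ (r • y) := by
    simp only [dotProduct, Pi.smul_apply, smul_eq_mul, hy]
    refine Finset.sum_congr rfl fun v _ => ?_
    rw [mul_left_comm, mul_left_comm |x v|, abs_mul_abs_self]
  have hzero : y ⬝ᵥ (algebraMap ℝ (Matrix V V ℝ) r - A) *ᵥ y = 0 := by
    refine le_antisymm ?_ (by simpa using hpsd.dotProduct_mulVec_nonneg y)
    rw [hmul, dotProduct_sub, ← heq, ← hx]
    linarith
  have hyA : A *ᵥ y = r • y := by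
    have := (hpsd.dotProduct_mulVec_zero_iff y).1 (by simpa using hzero)
    rw [hmul, sub_eq_zero] at this
    exact this.symm
  have hy0 : ∀ v, 0 ≤ y v := fun v => abs_nonneg _
  have hstep : ∀ u v, G.Adj u v → y u = 0 → y v = 0 := by
    intro u v huv hu
    have h1 := congrFun hyA u
    rw [hA, adjMatrix_mulVec_apply, Pi.smul_apply, hu, smul_zero,
      Finset.sum_eq_zero_iff_of_nonneg fun w _ => hy0 w] at h1
    exact h1 v (by simpa using huv)
  have hall : ∀ u v, y u = 0 → y v = 0 := by
    intro u v hu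
    obtain ⟨p⟩ := hG.preconnected u v
    induction p with
    | nil => exact hu
    | cons h _ ih => exact ih (hstep _ _ h hu)
  refine ⟨y, fun v => (hy0 v).lt_of_ne fun hv => hx0 ?_, hyA⟩
  funext u
  exact abs_eq_zero.1 (hall v u hv.symm)

-- Sum `d - 2` separately over `w`, its neighbours and its non-neighbours. The shift by 2 makes the
-- right side independent of `w` and, for minimum degree two, the non-neighbour term nonnegative.
open Classical in
theorem sum_neighborFinset_degree_eq {V : Type*} [Fintype V] (G : SimpleGraph V) (w : V) :
    (∑ u ∈ G.neighborFinset w, (G.degree u : ℝ)) - G.degree w +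
      ∑ u ∈ Gᶜ.neighborFinset w, ((G.degree u : ℝ) - 2) =
      (∑ u, (G.degree u : ℝ)) - 2 * (Fintype.card V - 1) := by
  have h1 : ∑ u, ((G.degree u : ℝ) - 2) = ((G.degree w : ℝ) - 2) +
      ∑ u ∈ G.neighborFinset w, ((G.degree u : ℝ) - 2) +
      ∑ u ∈ Gᶜ.neighborFinset w, ((G.degree u : ℝ) - 2) := by
    rw [← Finset.sum_erase_add _ _ (Finset.mem_univ w), add_comm, add_assoc]
    congr 1
    rw [← Finset.sum_union]
    · refine Finset.sum_congr ?_ fun _ _ => rfl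
      ext u
      by_cases h : G.Adj w u
      · simp [h, h.ne']
      · simp [h, eq_comm]
    · rw [Finset.disjoint_left]
      intro u hu
      simp at hu
      simp [hu]
  simp only [Finset.sum_sub_distrib, Finset.sum_const, card_neighborFinset_eq_degree,
    Finset.card_univ, nsmul_eq_mul] at h1 ⊢
  linarith

open Classical in
/-- The identity behind the Hong–Shu–Fang bound for minimum degree two. -/
theorem eigenvector_degree_identity {V : Type*} [Fintype V] {G : SimpleGraph V} {y : V → ℝ} {r : ℝ}
    (hy : G.adjMatrix ℝ *ᵥ y = r • y) :
    (r ^ 2 - r) * ∑ w, y w + ∑ w, (∑ u ∈ Gᶜ.neighborFinset w, ((G.degree u : ℝ) - 2)) * y w =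
      ((∑ u, (G.degree u : ℝ)) - 2 * (Fintype.card V - 1)) * ∑ w, y w := by
  -- By symmetry of the adjacency matrix; used for `z = 1` and for `z` the degree, which produce `r`
  -- and `r²`.
  have hz : ∀ z : V → ℝ, ∑ w, (∑ u ∈ G.neighborFinset w, z u) * y w = r * ∑ w, z w * y w := by
    intro z
    have h1 : (G.adjMatrix ℝ *ᵥ z) ⬝ᵥ y = z ⬝ᵥ G.adjMatrix ℝ *ᵥ y := by
      rw [Matrix.dotProduct_mulVec, ← Matrix.mulVec_transpose, transpose_adjMatrix]
    rw [hy, dotProduct_smul] at h1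
    simpa [dotProduct, adjMatrix_mulVec_apply] using h1
  have h1 : ∑ w, (G.degree w : ℝ) * y w = r * ∑ w, y w := by
    simpa using hz fun _ => 1
  have h2 := hz fun u => (G.degree u : ℝ)
  rw [h1] at h2
  have h3 : r ^ 2 - r = r * r - r := by ring
  rw [h3, sub_mul, mul_assoc, ← h2, ← h1, ← Finset.sum_sub_distrib, ← Finset.sum_add_distrib,
    Finset.mul_sum]
  refine Finset.sum_congr rfl fun w _ => ?_
  rw [← sum_neighborFinset_degree_eq G w]
  ring

-- The edge bound caps the right side of `eigenvector_degree_identity`, and the non-neighbour sum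
-- there is nonnegative. In the equality case that sum vanishes; since `y` is positive, a vertex
-- with a non-neighbour has degree 2.
open Classical in
theorem Connected.adjSpectralRadius_sq_sub_le {V : Type*} [Fintype V] {G : SimpleGraph V}
    (hG : G.Connected) (hdeg : ∀ v, 2 ≤ G.degree v)
    (hsum : ∑ v, G.degree v ≤ 4 * Fintype.card V - 6) (hV : 3 ≤ Fintype.card V) :
    G.adjSpectralRadius ^ 2 - G.adjSpectralRadius ≤ 2 * Fintype.card V - 4 ∧
    (G.adjSpectralRadius ^ 2 - G.adjSpectralRadius = 2 * Fintype.card V - 4 →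
      ∑ v, G.degree v = 4 * Fintype.card V - 6 ∧ ∀ v, G.degree v = 2 ∨ G.IsUniversal v) := by
  have := hG.nonempty
  obtain ⟨y, hy0, hy⟩ := hG.exists_pos_eigenvector
  have hid := eigenvector_degree_identity hy
  have hsum' : (∑ v, (G.degree v : ℝ)) ≤ 4 * Fintype.card V - 6 := by
    rw [← Nat.cast_sum]
    have h := (Nat.cast_le (α := ℝ)).2 hsum
    rw [Nat.cast_sub (by omega)] at h
    push_cast at h ⊢
    exact h
  have hY : 0 < ∑ w, y w := Finset.sum_pos (fun w _ => hy0 w) Finset.univ_nonempty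
  have hd : ∀ u, (0 : ℝ) ≤ (G.degree u : ℝ) - 2 := fun u => by
    have : (2 : ℝ) ≤ G.degree u := by exact_mod_cast hdeg u
    linarith
  have hex : ∀ w, 0 ≤ (∑ u ∈ Gᶜ.neighborFinset w, ((G.degree u : ℝ) - 2)) * y w := fun w =>
    mul_nonneg (Finset.sum_nonneg fun u _ => hd u) (hy0 w).le
  have hE := Finset.sum_nonneg fun w (_ : w ∈ Finset.univ) => hex w
  have hle : ((∑ u, (G.degree u : ℝ)) - 2 * (Fintype.card V - 1)) * ∑ w, y w ≤
      (2 * Fintype.card V - 4) * ∑ w, y w := mul_le_mul_of_nonneg_right (by linarith) hY.le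
  refine ⟨le_of_mul_le_mul_right (by linarith) hY, fun heq => ?_⟩
  rw [heq] at hid
  have hE0 : ∑ w, (∑ u ∈ Gᶜ.neighborFinset w, ((G.degree u : ℝ) - 2)) * y w = 0 :=
    le_antisymm (by linarith) hE
  constructor
  · rw [hE0, add_zero] at hid
    have h1 := mul_right_cancel₀ hY.ne' hid
    have h2 : ((∑ v, G.degree v : ℕ) : ℝ) = ((4 * Fintype.card V - 6 : ℕ) : ℝ) := by
      rw [Nat.cast_sub (by omega)]
      push_cast
      linarith
    exact_mod_cast h2
  · intro v
    by_contra! hcon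
    obtain ⟨h1, h2⟩ := hcon
    obtain ⟨w, hvw, hw⟩ : ∃ w, v ≠ w ∧ ¬ G.Adj v w := by
      by_contra! h
      exact h2 fun w hw => h w hw
    have h3 := (Finset.sum_eq_zero_iff_of_nonneg fun w _ => hex w).1 hE0 w (Finset.mem_univ _)
    have h4 := (mul_eq_zero.1 h3).resolve_right (hy0 w).ne'
    have h5 := (Finset.sum_eq_zero_iff_of_nonneg fun u _ => hd u).1 h4 v
      (by simp [hvw.symm, G.adj_comm, hw])
    exact h1 (by exact_mod_cast sub_eq_zero.1 h5)

/-! ### The equality case and the extremal graph -/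

-- With k universal vertices, k(n - 1) + 2(n - k) = 4n - 6 gives k = 2 if n > 3, and n = 3 is the
-- triangle. Two universal vertices use up the degree sum, so every other vertex has degree 2 and is
-- adjacent to these two only.
open Classical in
theorem exists_pair_isUniversal {V : Type*} [Fintype V] {G : SimpleGraph V}
    (hV : 3 ≤ Fintype.card V) (hsum : ∑ v, G.degree v = 4 * Fintype.card V - 6)
    (hdeg : ∀ v, G.degree v = 2 ∨ G.IsUniversal v) :
    ∃ u v, u ≠ v ∧ ∀ x y, G.Adj x y ↔ x ≠ y ∧ (x = u ∨ x = v ∨ y = u ∨ y = v) := by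
  have huniv : ∀ v, G.IsUniversal v → G.degree v = Fintype.card V - 1 := fun v hv =>
    (G.degree_eq_card_sub_one v).2 hv
  have hU : 2 ≤ (Finset.univ.filter fun v => G.IsUniversal v).card := by
    rcases hV.eq_or_lt with h3 | h3
    · have : (Finset.univ.filter fun v => G.IsUniversal v) = Finset.univ := by
        refine Finset.filter_true_of_mem fun v _ => (hdeg v).elim (fun h => ?_) id
        exact (G.degree_eq_card_sub_one v).1 (by omega)
      rw [this, Finset.card_univ]
      omega
    · have h1 := Finset.sum_filter_add_sum_filter_not Finset.univ (fun v => G.IsUniversal v)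
        fun v => G.degree v
      rw [Finset.sum_congr rfl fun v hv => huniv v (Finset.mem_filter.1 hv).2,
        Finset.sum_congr rfl fun v hv => (hdeg v).resolve_right (Finset.mem_filter.1 hv).2,
        Finset.sum_const, Finset.sum_const, hsum, smul_eq_mul, smul_eq_mul] at h1
      have h2 := Finset.card_filter_add_card_filter_not (s := Finset.univ) (fun v => G.IsUniversal v)
      rw [Finset.card_univ] at h2
      by_contra! hlt
      interval_cases (Finset.univ.filter fun v => G.IsUniversal v).card <;> omega
  obtain ⟨u, hu, v, hv, huv⟩ := Finset.one_lt_card.1 hU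
  simp only [Finset.mem_filter, Finset.mem_univ, true_and] at hu hv
  have hother : ∀ w, w ≠ u → w ≠ v → G.degree w = 2 := by
    have hge : ∀ w, 2 ≤ G.degree w := fun w => by
      rcases hdeg w with h | h
      · exact h.ge
      · rw [huniv w h]
        omega
    have h1 : ∑ w, G.degree w = ∑ w ∈ (Finset.univ.erase u).erase v, G.degree w +
        G.degree v + G.degree u := by
      rw [Finset.sum_erase_add _ _ (by simp [huv.symm]), Finset.sum_erase_add _ _ (by simp)]
    have hc : ((Finset.univ.erase u).erase v).card = Fintype.card V - 2 := by
      rw [Finset.card_erase_of_mem (by simp [huv.symm]), Finset.card_erase_of_mem (by simp),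
        Finset.card_univ]
      rfl
    have h2 : ∑ w ∈ (Finset.univ.erase u).erase v, 2 =
        ∑ w ∈ (Finset.univ.erase u).erase v, G.degree w := by
      rw [Finset.sum_const, hc, smul_eq_mul]
      have := huniv u hu
      have := huniv v hv
      omega
    intro w hwu hwv
    exact ((Finset.sum_eq_sum_iff_of_le fun w _ => hge w).1 h2 w (by simp [hwu, hwv])).symm
  refine ⟨u, v, huv, fun x y => ⟨fun h => ⟨h.ne, ?_⟩, ?_⟩⟩
  · by_contra! hcon
    obtain ⟨hxu, hxv, hyu, hyv⟩ := hcon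
    have hsub : {u, v, y} ⊆ G.neighborFinset x := by
      intro z hz
      simp only [Finset.mem_insert, Finset.mem_singleton] at hz
      rw [mem_neighborFinset]
      rcases hz with rfl | rfl | rfl
      · exact (hu hxu.symm).symm
      · exact (hv hxv.symm).symm
      · exact h
    have hcard := Finset.card_le_card hsub
    rw [Finset.card_eq_three.2 ⟨u, v, y, huv, hyu.symm, hyv.symm, rfl⟩,
      card_neighborFinset_eq_degree, hother x hxu hxv] at hcard
    omega
  · rintro ⟨hxy, rfl | rfl | rfl | rfl⟩
    · exact hu hxy
    · exact hv hxy
    · exact (hu hxy.symm).symm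
    · exact (hv hxy.symm).symm

theorem nonempty_iso_K2JoinEmpty {V : Type*} [Fintype V] {G : SimpleGraph V} {u v : V}
    (huv : u ≠ v) (h : ∀ x y, G.Adj x y ↔ x ≠ y ∧ (x = u ∨ x = v ∨ y = u ∨ y = v)) :
    Nonempty (G ≃g K2JoinEmpty (Fintype.card V)) := by
  classical
  have h2 : Fintype.card {x : V // x = u ∨ x = v} = 2 := by
    rw [Fintype.card_subtype, ← Finset.card_pair huv]
    congr 1
    ext x
    simp
  have hn : Fintype.card {x : V // ¬ (x = u ∨ x = v)} = Fintype.card V - 2 := by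
    rw [Fintype.card_subtype_compl, h2]
  let e : Fin 2 ⊕ Fin (Fintype.card V - 2) ≃ V :=
    (Equiv.sumCongr (Fintype.equivFinOfCardEq h2).symm (Fintype.equivFinOfCardEq hn).symm).trans
      (Equiv.sumCompl fun x : V => x = u ∨ x = v)
  have hl : ∀ i, e (Sum.inl i) = u ∨ e (Sum.inl i) = v := fun i =>
    ((Fintype.equivFinOfCardEq h2).symm i).2
  have hr : ∀ i, ¬ (e (Sum.inr i) = u ∨ e (Sum.inr i) = v) := fun i =>
    ((Fintype.equivFinOfCardEq hn).symm i).2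
  refine ⟨RelIso.symm ⟨e, ?_⟩⟩
  rintro (a | a) (b | b)
  · rw [h]
    have := hl a
    simp only [K2JoinEmpty, joinGraph, top_adj, ne_eq, e.injective.eq_iff, Sum.inl.injEq]
    tauto
  · rw [h]
    have := hl a
    simp only [K2JoinEmpty, joinGraph, ne_eq, e.injective.eq_iff, reduceCtorEq]
    tauto
  · rw [h]
    have := hl b
    simp only [K2JoinEmpty, joinGraph, ne_eq, e.injective.eq_iff, reduceCtorEq]
    tauto
  · rw [h]
    have := hr a
    have := hr b
    simp only [K2JoinEmpty, joinGraph, bot_adj]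
    tauto

theorem Iso.adjSpectralRadius_eq {V W : Type*} [Fintype V] [Fintype W] {G : SimpleGraph V}
    {H : SimpleGraph W} (f : G ≃g H) : G.adjSpectralRadius = H.adjSpectralRadius := by
  classical
  unfold adjSpectralRadius
  rw [← AlgEquiv.spectrum_eq (Matrix.reindexAlgEquiv ℝ ℝ f.toEquiv)]
  congr 2
  ext i j
  have h : G.Adj (f.symm i) (f.symm j) ↔ H.Adj i j := f.symm.map_adj_iff
  simp only [Matrix.coe_reindexAlgEquiv, Matrix.reindex_apply, Matrix.submatrix_apply,
    adjMatrix_apply]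
  exact if_congr h rfl rfl

open Classical in
theorem IsMinimallyRigid.two_le_degree {V : Type*} [Fintype V] {G : SimpleGraph V}
    (hG : IsMinimallyRigid 2 G) (hc : G.Connected) (hV : 3 ≤ Fintype.card V) (v : V) :
    2 ≤ G.degree v := by
  have : Nontrivial V := Fintype.one_lt_card_iff_nontrivial.1 (by omega)
  have hpos := hc.preconnected.degree_pos_of_nontrivial v
  by_contra! hlt
  obtain ⟨u, hu⟩ := (G.degree_pos_iff_exists_adj v).1 hpos
  obtain ⟨w, hw⟩ : ∃ w, w ∉ ({u, v} : Finset V) := by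
    by_contra! h
    have := Finset.card_le_card (fun x _ => h x : Finset.univ ⊆ ({u, v} : Finset V))
    have := Finset.card_le_two (a := u) (b := v)
    rw [Finset.card_univ] at *
    omega
  simp only [Finset.mem_insert, Finset.mem_singleton, not_or] at hw
  refine not_isRigid_of_subsingleton_neighbor hu.ne' (Ne.symm hw.1) (Ne.symm hw.2)
    (fun x hx => ?_) hG.1
  have h1 : (G.neighborFinset v).card ≤ 1 := by
    rw [card_neighborFinset_eq_degree]
    omega
  exact Finset.card_le_one.1 h1 x (by simpa using hx) u (by simpa using hu)

open Classical in
theorem IsMinimallyRigid.sum_degree_le {V : Type*} [Fintype V] {G : SimpleGraph V}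
    (hG : IsMinimallyRigid 2 G) (hV : 3 ≤ Fintype.card V) :
    ∑ v, G.degree v ≤ 4 * Fintype.card V - 6 := by
  have h := ncard_edgeSet_le_of_algebraicIndependent (by rw [Nat.card_eq_fintype_card]; omega)
    hG.algebraicIndependent
  rw [Nat.card_eq_fintype_card, Set.ncard_eq_toFinset_card'] at h
  rw [sum_degrees_eq_twice_card_edges, edgeFinset]
  omega

theorem sq_half_one_add_sqrt {n : ℕ} (hn : 3 ≤ n) :
    ((1 + √(8 * (n : ℝ) - 15)) / 2) ^ 2 - (1 + √(8 * (n : ℝ) - 15)) / 2 = 2 * n - 4 := by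
  have h3 : (3 : ℝ) ≤ n := by exact_mod_cast hn
  have := Real.sq_sqrt (show 0 ≤ 8 * (n : ℝ) - 15 by linarith)
  linear_combination this / 4

theorem le_half_one_add_sqrt {n : ℕ} {r : ℝ} (h : r ^ 2 - r ≤ 2 * n - 4) :
    r ≤ (1 + √(8 * (n : ℝ) - 15)) / 2 := by
  have := Real.le_sqrt_of_sq_le (x := 2 * r - 1) (y := 8 * (n : ℝ) - 15) (by linarith)
  linarith

/-- The upper bound is the general inequality applied to this graph; an explicit eigenvector attains
it. -/
theorem adjSpectralRadius_K2JoinEmpty {n : ℕ} (hn : 3 ≤ n) :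
    (K2JoinEmpty n).adjSpectralRadius = (1 + √(8 * (n : ℝ) - 15)) / 2 := by
  classical
  have hcard : Fintype.card (Fin 2 ⊕ Fin (n - 2)) = n := by simp; omega
  have hmin := K2JoinEmpty_isMinimallyRigid n
  have hc := K2JoinEmpty_connected n
  have hV : 3 ≤ Fintype.card (Fin 2 ⊕ Fin (n - 2)) := hcard.ge.trans' hn
  refine le_antisymm (le_half_one_add_sqrt ?_) ?_
  · have := (hc.adjSpectralRadius_sq_sub_le (fun v => by convert hmin.two_le_degree hc hV v)
      (by convert hmin.sum_degree_le hV) hV).1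
    rwa [hcard] at this
  · have hne := hc.nonempty
    refine (isGreatest_adjSpectralRadius (K2JoinEmpty n)).2 ?_
    rw [mem_spectrum_adjMatrix_iff]
    have hsq := sq_half_one_add_sqrt hn
    set r := (1 + √(8 * (n : ℝ) - 15)) / 2
    -- At a hub the eigenvalue equation reads `r + 2 (n - 2) = r²`, at any other vertex `r + r = r *
    -- 2`.
    refine ⟨Sum.elim (fun _ => r) (fun _ => 2), fun h => ?_, ?_⟩
    · have := congrFun h (Sum.inr ⟨0, by omega⟩)
      simp at this
    · funext v
      rw [adjMatrix_mulVec_apply, neighborFinset_eq_filter, Finset.sum_filter,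
        Fintype.sum_sum_type]
      rcases v with i | i
      · have h1 : ∑ j : Fin 2, (if i ≠ j then r else 0) = r := by
          rw [Fin.sum_univ_two]
          fin_cases i <;> simp
        have hn2 : ((n - 2 : ℕ) : ℝ) = n - 2 := by
          rw [Nat.cast_sub (by omega)]
          norm_num
        simp [K2JoinEmpty, joinGraph, hn2] at h1 ⊢
        rw [h1]
        linear_combination -hsq
      · simp [K2JoinEmpty, joinGraph]
        ring

end SimpleGraph

theorem theorem1p3 (n : ℕ) (hn : 3 ≤ n) :
    -- the extremal graph belongs to the class
    (Fintype.card (Fin 2 ⊕ Fin (n - 2)) = n ∧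
      (SimpleGraph.K2JoinEmpty n).Connected ∧
      SimpleGraph.IsMinimallyRigid 2 (SimpleGraph.K2JoinEmpty n)) ∧
    -- its spectral radius
    (SimpleGraph.K2JoinEmpty n).adjSpectralRadius = (1 + Real.sqrt (8 * (n : ℝ) - 15)) / 2 ∧
    -- it is the unique maximizer, up to isomorphism
    (∀ (V : Type*) [Fintype V] (G : SimpleGraph V), Fintype.card V = n →
      G.Connected → SimpleGraph.IsMinimallyRigid 2 G →
        G.adjSpectralRadius ≤ (SimpleGraph.K2JoinEmpty n).adjSpectralRadius ∧
        (G.adjSpectralRadius = (SimpleGraph.K2JoinEmpty n).adjSpectralRadius ↔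
          Nonempty (G ≃g SimpleGraph.K2JoinEmpty n))) := by
  refine ⟨⟨by simp; omega, SimpleGraph.K2JoinEmpty_connected n,
    SimpleGraph.K2JoinEmpty_isMinimallyRigid n⟩, SimpleGraph.adjSpectralRadius_K2JoinEmpty hn, ?_⟩
  rintro V _ G rfl hc hG
  obtain ⟨hle, heq⟩ := hc.adjSpectralRadius_sq_sub_le (hG.two_le_degree hc hn)
    (hG.sum_degree_le hn) hn
  refine ⟨?_, fun h => ?_, fun ⟨f⟩ => f.adjSpectralRadius_eq⟩
  · rw [SimpleGraph.adjSpectralRadius_K2JoinEmpty hn]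
    exact SimpleGraph.le_half_one_add_sqrt hle
  · rw [SimpleGraph.adjSpectralRadius_K2JoinEmpty hn] at h
    obtain ⟨hsum, hdeg⟩ := heq (by rw [h, SimpleGraph.sq_half_one_add_sqrt hn])
    obtain ⟨u, v, huv, hadj⟩ := SimpleGraph.exists_pair_isUniversal hn hsum hdeg
    exact SimpleGraph.nonempty_iso_K2JoinEmpty huv hadj
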